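/- Let $n,k,\lambda$ be positive integers with $\lambda n\le\lambda k$, and let $\rho=(\rho_1,\dots,\rho_k)$ be a $k$-tuple of integers with $1\le\rho_\ell\le\lambda n$ for every $\ell\in[k]=\{1,\dots,k\}$ and $\sum_{\ell=1}^{k}\rho_\ell=\lambda n^2$. An $n\times n$ $(\rho,\lambda)$-Latin square is an $n\times n$ array in which each cell contains a multiset of exactly $\lambda$ elements (counted with multiplicity) of the symbol set $[k]$, such that every symbol $\ell\in[k]$ occurs exactly $\rho_\ell$ times in the whole array, at most $\lambda$ times in each row, and at most $\lambda$ times in each column (all occurrences counted with multiplicity). It is simple if no symbol occurs more than once in any cell. Then: (1) an $n\times n$ $(\rho,\lambda)$-Latin square exists; (2) a simple $n\times n$ $(\rho,\lambda)$-Latin square exists if and only if $\lambda\le k$ and $\rho_\ell\le n^2$ for every $\ell\in[k]$. -/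

import Mathlib

/-- An `r × s` array on the symbols `Fin k`, each cell of which contains a multiset of symbols. -/
abbrev SymbolArray (r s k : ℕ) : Type := Fin r → Fin s → Multiset (Fin k)

namespace SymbolArray

/-- The array is a `lam`-matrix: every cell contains exactly `lam` symbols, counted with
multiplicity. -/
def IsMatrix {r s k : ℕ} (M : SymbolArray r s k) (lam : ℕ) : Prop :=
  ∀ i j, (M i j).card = lam

/-- The number of occurrences of the symbol `l` in the cell `(i, j)`. -/
def cellCount {r s k : ℕ} (M : SymbolArray r s k) (l : Fin k) (i : Fin r) (j : Fin s) : ℕ :=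
  (M i j).count l

/-- The number of occurrences of the symbol `l` in row `i`. -/
def rowCount {r s k : ℕ} (M : SymbolArray r s k) (l : Fin k) (i : Fin r) : ℕ :=
  ∑ j, M.cellCount l i j

/-- The number of occurrences of the symbol `l` in column `j`. -/
def colCount {r s k : ℕ} (M : SymbolArray r s k) (l : Fin k) (j : Fin s) : ℕ :=
  ∑ i, M.cellCount l i j

/-- The number of occurrences of the symbol `l` in the whole array. -/
def totalCount {r s k : ℕ} (M : SymbolArray r s k) (l : Fin k) : ℕ :=
  ∑ i, ∑ j, M.cellCount l i j

/-- The `n × n` array `M` is a `(rho, lam)`-Latin square. -/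
structure IsLatinSquare {n k : ℕ} (M : SymbolArray n n k) (rho : Fin k → ℕ) (lam : ℕ) :
    Prop where
  isMatrix : M.IsMatrix lam
  totalCount_eq : ∀ l, M.totalCount l = rho l
  rowCount_le : ∀ l i, M.rowCount l i ≤ lam
  colCount_le : ∀ l j, M.colCount l j ≤ lam

/-- No symbol is repeated in any cell. -/
def IsSimple {r s k : ℕ} (M : SymbolArray r s k) : Prop :=
  ∀ l i j, M.cellCount l i j ≤ 1

end SymbolArray

/-! Record an array by the numbers of copies of each symbol in each cell. Split the vector `rho`
equitably into `n` columns, then the resulting symbol × column matrix equitably into `n` rows. Parts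
differing by at most one with total `n * c` all equal `c`, and with total at most `n * c` are all at
most `c`; this gives cell sizes `lam`, the row and column bounds, and simplicity when `rho l ≤ n ^
2`. Conversely, a simple cell is a set, and a symbol fills each cell at most once. An equitable
splitting is one minimising the sum of squares of entries and margins: two unbalanced parts could be
re-split by `exists_balanced_halving`, lowering the sum. Halving 2-colours the odd entries, viewed
as edges of a bipartite graph, so that the colours balance at each vertex. -/

/-! ### Balanced 2-colourings and halving -/

open Equiv in
/-- Two fixed-point-free involutions of a countable type admit a common proper 2-colouring. -/
theorem exists_bool_coloring_of_involutions {D : Type*} [Countable D] (σ τ : Perm D)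
    (hσ : ∀ x, σ (σ x) = x) (hτ : ∀ x, τ (τ x) = x) (hσ' : ∀ x, σ x ≠ x) (hτ' : ∀ x, τ x ≠ x) :
    ∃ c : D → Bool, (∀ x, c (σ x) = !c x) ∧ ∀ x, c (τ x) = !c x := by
  set π : Perm D := σ * τ with hπ
  have hσσ : σ * σ = 1 := Perm.ext hσ
  have hττ : τ * τ = 1 := Perm.ext hτ
  have hσi : σ⁻¹ = σ := inv_eq_of_mul_eq_one_left hσσ
  have hτi : τ⁻¹ = τ := inv_eq_of_mul_eq_one_left hττ
  have hconj : ∀ m : ℤ, σ * π ^ m = π ^ (-m) * σ := by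
    intro m
    have h1 : σ * π * σ⁻¹ = π⁻¹ := by
      rw [hπ, mul_inv_rev, hσi, hτi, ← mul_assoc, hσσ, one_mul]
    have h2 : σ * π ^ m * σ⁻¹ = π ^ (-m) := by
      rw [← conj_zpow, h1, inv_zpow, zpow_neg]
    rw [← h2, inv_mul_cancel_right]
  have hconj' : ∀ (m : ℤ) x, σ ((π ^ m) x) = (π ^ (-m)) (σ x) := fun m x =>
    congrArg (fun f : Perm D => f x) (hconj m)
  have hτπ : ∀ x, τ x = σ (π x) := fun x => by simp [hπ, hσ]
  have hadd : ∀ (a b : ℤ) x, (π ^ a) ((π ^ b) x) = (π ^ (a + b)) x := fun a b x => by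
    rw [zpow_add]; rfl
  -- If `σ x = π ^ m x`, the point halfway along is fixed by `σ` (`m` even) or by `τ` (`m` odd).
  have hne : ∀ x, ¬ π.SameCycle x (σ x) := by
    rintro x ⟨m, hm⟩
    obtain ⟨j, hj⟩ | ⟨j, hj⟩ := Int.even_or_odd m
    · apply hσ' ((π ^ j) x)
      rw [hconj', ← hm, hadd]
      congr 2; omega
    · apply hτ' ((π ^ j) x)
      have : π ((π ^ j) x) = (π ^ (1 + j)) x := by rw [← hadd, zpow_one]
      rw [hτπ, this, hconj', ← hm, hadd]
      congr 2; omega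
  let s := Perm.SameCycle.setoid π
  obtain ⟨rank, hrank⟩ := Countable.exists_injective_nat (Quotient s)
  let q : D → ℕ := fun x => rank (Quotient.mk s x)
  have hq : ∀ {x y}, q x = q y ↔ π.SameCycle x y := fun {x y} =>
    hrank.eq_iff.trans Quotient.eq
  have hne' : ∀ x, q x ≠ q (σ x) := fun x h => hne x (hq.1 h)
  have hστ : ∀ x, q (σ x) = q (τ x) := fun x => by
    rw [hq, hτπ]
    refine ⟨-1, ?_⟩
    have := hconj' 1 x
    rw [zpow_one] at this
    exact this.symm
  have hστ' : ∀ x, q (σ (τ x)) = q x := fun x => by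
    rw [hστ, hτ]
  -- Both `σ` and `τ` swap the `π`-orbit of `x` with the same other orbit; the lower-ranked of the
  -- two is coloured `true`.
  refine ⟨fun x => decide (q x < q (σ x)), fun x => ?_, fun x => ?_⟩
  · have := hne' x
    rw [Bool.eq_iff_iff]
    simp only [hσ, decide_eq_true_eq, Bool.not_eq_true', decide_eq_false_iff_not]
    omega
  · have := hne' x
    rw [Bool.eq_iff_iff]
    simp only [hστ', ← hστ, decide_eq_true_eq, Bool.not_eq_true', decide_eq_false_iff_not]
    omega

/-- The elements of each fibre of a map on a finite type can be paired up, with at most one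
element left over. -/
theorem exists_involutive_fiberwise {E R : Type*} [Finite E] (r : E → R) :
    ∃ σ : E → E, Function.Involutive σ ∧ (∀ x, r (σ x) = r x) ∧
      ∀ x y, r x = r y → σ x = x → σ y = y → x = y := by
  classical
  let φ := fun y : R => Finite.equivFin {x // r x = y}
  -- Reversing an enumeration of the fibre fixes at most its middle element.
  let σ : E → E := fun x => ((φ (r x)).symm (Fin.rev (φ (r x) ⟨x, rfl⟩))).1
  have hσ : ∀ x y (h : r x = y), σ x = ((φ y).symm (Fin.rev (φ y ⟨x, h⟩))).1 := by
    rintro x _ rfl; rfl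
  have hr : ∀ x, r (σ x) = r x := fun x => ((φ (r x)).symm (Fin.rev (φ (r x) ⟨x, rfl⟩))).2
  refine ⟨σ, fun x => ?_, hr, fun x y hxy hx hy => ?_⟩
  · rw [hσ (σ x) (r x) (hr x)]
    simp [σ]
  · have key : ∀ z (h : r z = r y), σ z = z →
        2 * (φ (r y) ⟨z, h⟩ : ℕ) + 1 = Nat.card {x // r x = r y} := by
      intro z h hz
      have h1 : (φ (r y)).symm (Fin.rev (φ (r y) ⟨z, h⟩)) = ⟨z, h⟩ :=
        Subtype.ext ((hσ z _ h).symm.trans hz)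
      rw [Equiv.symm_apply_eq] at h1
      have h2 := congrArg Fin.val h1
      rw [Fin.val_rev] at h2
      have := (φ (r y) ⟨z, h⟩).isLt
      omega
    have h1 := key x hxy hx
    have h2 := key y rfl hy
    have h3 : φ (r y) ⟨x, hxy⟩ = φ (r y) ⟨y, rfl⟩ := Fin.ext (by omega)
    exact congrArg Subtype.val ((φ (r y)).injective h3)

/-- A fibre sum of a sign that alternates along a fibrewise pairing is at most one in absolute
value. -/
theorem abs_sum_fiber_le_one_of_involutive {E R : Type*} [Fintype E] [DecidableEq R] (r : E → R)
    (σ : E → E) (hσ : Function.Involutive σ) (hr : ∀ x, r (σ x) = r x)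
    (hfix : ∀ x y, r x = r y → σ x = x → σ y = y → x = y)
    (ε : E → ℤ) (hε : ∀ x, |ε x| ≤ 1) (hεσ : ∀ x, σ x ≠ x → ε (σ x) = -ε x) (t : R) :
    |∑ x with r x = t, ε x| ≤ 1 := by
  classical
  rw [← Finset.sum_filter_add_sum_filter_not _ (fun x => σ x = x)]
  have h0 : ∑ x ∈ (Finset.univ.filter (fun x => r x = t)).filter (fun x => ¬ σ x = x), ε x = 0 := by
    refine Finset.sum_involution (fun x _ => σ x) ?_ ?_ ?_ ?_
    · intro x hx
      rw [hεσ x (Finset.mem_filter.1 hx).2]; ring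
    · intro x hx _
      exact (Finset.mem_filter.1 hx).2
    · intro x hx
      simp only [Finset.mem_filter, Finset.mem_univ, true_and] at hx ⊢
      exact ⟨(hr x).trans hx.1, fun h => hx.2 (hσ.injective h)⟩
    · intro x _
      exact hσ x
  rw [h0, add_zero]
  have hcard : ((Finset.univ.filter (fun x => r x = t)).filter (fun x => σ x = x)).card ≤ 1 := by
    rw [Finset.card_le_one]
    intro x hx y hy
    simp only [Finset.mem_filter, Finset.mem_univ, true_and] at hx hy
    exact hfix x y (hx.1.trans hy.1.symm) hx.2 hy.2
  calc _ ≤ ∑ x ∈ (Finset.univ.filter (fun x => r x = t)).filter (fun x => σ x = x), |ε x| :=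
        Finset.abs_sum_le_sum_abs _ _
    _ ≤ ∑ x ∈ (Finset.univ.filter (fun x => r x = t)).filter (fun x => σ x = x), (1 : ℤ) :=
        Finset.sum_le_sum fun x _ => hε x
    _ ≤ 1 := by simpa using hcard

/-- Given two maps on a finite type, one can 2-colour the elements so that each fibre of either
map is halved up to one element. -/
theorem exists_sign_abs_sum_fiber_le_one {E R C : Type*} [Fintype E] [DecidableEq R]
    [DecidableEq C] (r : E → R) (c : E → C) :
    ∃ b : E → Bool, (∀ t, |∑ x with r x = t, (if b x then (1 : ℤ) else -1)| ≤ 1) ∧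
      ∀ t, |∑ x with c x = t, (if b x then (1 : ℤ) else -1)| ≤ 1 := by
  classical
  obtain ⟨σ, hσ, hσr, hσf⟩ := exists_involutive_fiberwise r
  obtain ⟨τ, hτ, hτc, hτf⟩ := exists_involutive_fiberwise c
  -- Doubling `E` removes fixed points: each is swapped with its twin. The colouring is then read
  -- off on the `false` copy.
  let lift : (E → E) → E × Bool → E × Bool := fun f x =>
    if f x.1 = x.1 then (x.1, !x.2) else (f x.1, x.2)
  have lift_inv : ∀ f : E → E, Function.Involutive f → Function.Involutive (lift f) := by
    rintro f hf ⟨x, b⟩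
    by_cases h : f x = x
    · simp [lift, h]
    · simp [lift, h, hf x, Ne.symm h]
  have lift_ne : ∀ (f : E → E) x, lift f x ≠ x := by
    rintro f ⟨x, b⟩
    by_cases h : f x = x <;> simp [lift, h]
  obtain ⟨col, h1, h2⟩ := exists_bool_coloring_of_involutions
    (lift_inv σ hσ).toPerm (lift_inv τ hτ).toPerm (lift_inv σ hσ) (lift_inv τ hτ)
    (lift_ne σ) (lift_ne τ)
  have alt : ∀ f : E → E, (∀ x, col (lift f x) = !col x) → ∀ x, f x ≠ x →
      (if col (f x, false) then (1 : ℤ) else -1) = -(if col (x, false) then (1 : ℤ) else -1) := by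
    intro f hf x hx
    have := hf (x, false)
    simp only [lift, hx, if_false] at this
    rw [this]
    cases col (x, false) <;> simp
  have habs : ∀ x, |(if col (x, false) then (1 : ℤ) else -1)| ≤ 1 := fun x => by
    split_ifs <;> simp
  exact ⟨fun x => col (x, false),
    abs_sum_fiber_le_one_of_involutive r σ hσ hσr hσf _ habs (alt σ h1),
    abs_sum_fiber_le_one_of_involutive c τ hτ hτc hτf _ habs (alt τ h2)⟩

/-- A nonnegative integer matrix splits into two halves, up to rounding of entries, row sums and
column sums. -/
theorem exists_balanced_halving {L J : Type*} [Fintype L] [Fintype J] (H : L → J → ℕ) :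
    ∃ A B : L → J → ℕ, (∀ l j, A l j + B l j = H l j) ∧
      (∀ l j, |(A l j : ℤ) - B l j| ≤ 1) ∧
      (∀ l, |((∑ j, A l j : ℕ) : ℤ) - (∑ j, B l j : ℕ)| ≤ 1) ∧
      ∀ j, |((∑ l, A l j : ℕ) : ℤ) - (∑ l, B l j : ℕ)| ≤ 1 := by
  classical
  -- Even entries halve exactly; the sign of an odd entry says which half gets the extra unit.
  let E := {x : L × J // H x.1 x.2 % 2 = 1}
  obtain ⟨b, hb1, hb2⟩ := exists_sign_abs_sum_fiber_le_one
    (fun x : E => x.1.1) (fun x : E => x.1.2)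
  let A : L → J → ℕ := fun l j =>
    H l j / 2 + if h : H l j % 2 = 1 then (if b ⟨(l, j), h⟩ then 1 else 0) else 0
  let B : L → J → ℕ := fun l j =>
    H l j / 2 + if h : H l j % 2 = 1 then (if b ⟨(l, j), h⟩ then 0 else 1) else 0
  let s : L → J → ℤ := fun l j =>
    if h : H l j % 2 = 1 then (if b ⟨(l, j), h⟩ then 1 else -1) else 0
  have hs : ∀ l j, (A l j : ℤ) - B l j = s l j := by
    intro l j
    by_cases h : H l j % 2 = 1
    · by_cases hb : b ⟨(l, j), h⟩ <;> simp [A, B, s, h, hb]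
    · simp [A, B, s, h]
  have hsE : ∀ (P : L × J → Prop) [DecidablePred P],
      ∑ x : L × J with P x, s x.1 x.2 = ∑ x : E with P x.1, (if b x then (1 : ℤ) else -1) := by
    intro P _
    rw [Finset.sum_filter, Finset.sum_filter,
      ← Fintype.sum_subtype_add_sum_subtype (fun x : L × J => H x.1 x.2 % 2 = 1)]
    rw [Finset.sum_eq_zero (s := (Finset.univ : Finset {x : L × J // ¬ H x.1 x.2 % 2 = 1})),
      add_zero]
    · refine Finset.sum_congr rfl fun x _ => ?_
      simp [s, x.2]
    · intro x _
      simp [s, x.2]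
  refine ⟨A, B, fun l j => ?_, fun l j => ?_, fun l => ?_, fun j => ?_⟩
  · by_cases h : H l j % 2 = 1
    · by_cases hb : b ⟨(l, j), h⟩ <;> simp only [A, B, h, hb, dif_pos, if_true] <;> simp <;> omega
    · simp only [A, B, h, dif_neg, not_false_eq_true]; omega
  · rw [hs]
    simp only [s]
    split_ifs <;> simp
  · have h := hb1 l
    rw [← hsE (fun x => x.1 = l)] at h
    convert h using 2
    push_cast
    rw [← Finset.sum_sub_distrib, Finset.sum_filter, Fintype.sum_prod_type]
    simp [hs]
  · have h := hb2 j
    rw [← hsE (fun x => x.2 = j)] at h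
    convert h using 2
    push_cast
    rw [← Finset.sum_sub_distrib, Finset.sum_filter, Fintype.sum_prod_type]
    simp [hs]

/-! ### Equitable splitting by minimising squares -/

/-- Since `2(a² + b²) = (a + b)² + (a - b)²`, only the difference matters, and parity forces `a = b`
when `x = y`. -/
theorem sq_add_sq_le_of_abs_sub_le_one {x y a b : ℕ} (h : a + b = x + y)
    (hab : |(a : ℤ) - b| ≤ 1) : a ^ 2 + b ^ 2 ≤ x ^ 2 + y ^ 2 := by
  zify at h ⊢
  have h1 : ((a : ℤ) - b) ^ 2 ≤ (x - y : ℤ) ^ 2 := by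
    by_cases hxy : (x : ℤ) = y
    · have : (a : ℤ) = b := by rw [abs_le] at hab; omega
      simp [this, hxy]
    · apply sq_le_sq.2
      exact hab.trans (Int.one_le_abs (sub_ne_zero.2 hxy))
  nlinarith

theorem sq_add_sq_lt_of_abs_sub_le_one {x y a b : ℕ} (h : a + b = x + y)
    (hab : |(a : ℤ) - b| ≤ 1) (hxy : y + 1 < x) : a ^ 2 + b ^ 2 < x ^ 2 + y ^ 2 := by
  zify at h hxy ⊢
  have h1 : ((a : ℤ) - b) ^ 2 < (x - y : ℤ) ^ 2 := by
    apply sq_lt_sq.2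
    exact lt_of_le_of_lt hab (lt_of_lt_of_le (by linarith) (le_abs_self _))
  nlinarith

theorem Finset.sum_lt_sum_of_eq_off_pair {ι : Type*} [Fintype ι] [DecidableEq ι] {f g : ι → ℕ}
    {a b : ι} (hab : a ≠ b) (hoff : ∀ i, i ≠ a → i ≠ b → g i = f i)
    (hlt : g a + g b < f a + f b) : ∑ i, g i < ∑ i, f i := by
  rw [← Finset.sum_sdiff (Finset.subset_univ {a, b}), ← Finset.sum_sdiff (s₂ := Finset.univ)
    (f := f) (Finset.subset_univ {a, b}), Finset.sum_pair hab, Finset.sum_pair hab,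
    Finset.sum_congr rfl (g := f)]
  · exact Nat.add_lt_add_left hlt _
  · intro i hi
    simp only [Finset.mem_sdiff, Finset.mem_univ, Finset.mem_insert, Finset.mem_singleton,
      true_and, not_or] at hi
    exact hoff i hi.1 hi.2

/-- The sum of the squares of all entries, row sums and column sums of a matrix. -/
def marginSqSum {L J : Type*} [Fintype L] [Fintype J] (A : L → J → ℕ) : ℕ :=
  ∑ l, ∑ j, A l j ^ 2 + ∑ l, (∑ j, A l j) ^ 2 + ∑ j, (∑ l, A l j) ^ 2

/-- If rebalancing two matrices does not lower the sum of squares, they were balanced. -/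
theorem balanced_of_marginSqSum_le {L J : Type*} [Fintype L] [Fintype J] {X Y A B : L → J → ℕ}
    (hAB : ∀ l j, A l j + B l j = X l j + Y l j) (h1 : ∀ l j, |(A l j : ℤ) - B l j| ≤ 1)
    (h2 : ∀ l, |((∑ j, A l j : ℕ) : ℤ) - (∑ j, B l j : ℕ)| ≤ 1)
    (h3 : ∀ j, |((∑ l, A l j : ℕ) : ℤ) - (∑ l, B l j : ℕ)| ≤ 1)
    (hΦ : marginSqSum X + marginSqSum Y ≤ marginSqSum A + marginSqSum B) :
    (∀ l j, X l j ≤ Y l j + 1) ∧ (∀ l, ∑ j, X l j ≤ ∑ j, Y l j + 1) ∧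
      ∀ j, ∑ l, X l j ≤ ∑ l, Y l j + 1 := by
  have hr : ∀ l, ∑ j, A l j + ∑ j, B l j = ∑ j, X l j + ∑ j, Y l j := fun l => by
    simp only [← Finset.sum_add_distrib, hAB]
  have hc : ∀ j, ∑ l, A l j + ∑ l, B l j = ∑ l, X l j + ∑ l, Y l j := fun j => by
    simp only [← Finset.sum_add_distrib, hAB]
  have e1 : ∀ l j, A l j ^ 2 + B l j ^ 2 ≤ X l j ^ 2 + Y l j ^ 2 := fun l j =>
    sq_add_sq_le_of_abs_sub_le_one (hAB l j) (h1 l j)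
  have e2 : ∀ l, (∑ j, A l j) ^ 2 + (∑ j, B l j) ^ 2 ≤ (∑ j, X l j) ^ 2 + (∑ j, Y l j) ^ 2 :=
    fun l => sq_add_sq_le_of_abs_sub_le_one (hr l) (h2 l)
  have e3 : ∀ j, (∑ l, A l j) ^ 2 + (∑ l, B l j) ^ 2 ≤ (∑ l, X l j) ^ 2 + (∑ l, Y l j) ^ 2 :=
    fun j => sq_add_sq_le_of_abs_sub_le_one (hc j) (h3 j)
  have s0 : ∀ l, ∑ j, (A l j ^ 2 + B l j ^ 2) ≤ ∑ j, (X l j ^ 2 + Y l j ^ 2) :=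
    fun l => Finset.sum_le_sum fun j _ => e1 l j
  have s1 := Finset.sum_le_sum fun l (_ : l ∈ Finset.univ) => s0 l
  have s2 := Finset.sum_le_sum fun l (_ : l ∈ Finset.univ) => e2 l
  have s3 := Finset.sum_le_sum fun j (_ : j ∈ Finset.univ) => e3 j
  simp only [marginSqSum] at hΦ
  refine ⟨fun l j => ?_, fun l => ?_, fun j => ?_⟩ <;> by_contra! hlt
  · have s1' : ∑ l, ∑ j, (A l j ^ 2 + B l j ^ 2) < ∑ l, ∑ j, (X l j ^ 2 + Y l j ^ 2) :=
      Finset.sum_lt_sum (fun l _ => s0 l) ⟨l, Finset.mem_univ _,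
        Finset.sum_lt_sum (fun j _ => e1 l j) ⟨j, Finset.mem_univ _,
          sq_add_sq_lt_of_abs_sub_le_one (hAB l j) (h1 l j) hlt⟩⟩
    simp only [Finset.sum_add_distrib] at s1' s2 s3
    linarith
  · have s2' := Finset.sum_lt_sum (fun l _ => e2 l) ⟨l, Finset.mem_univ _,
      sq_add_sq_lt_of_abs_sub_le_one (hr l) (h2 l) hlt⟩
    simp only [Finset.sum_add_distrib] at s1 s2' s3
    linarith
  · have s3' := Finset.sum_lt_sum (fun j _ => e3 j) ⟨j, Finset.mem_univ _,
      sq_add_sq_lt_of_abs_sub_le_one (hc j) (h3 j) hlt⟩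
    simp only [Finset.sum_add_distrib] at s1 s2 s3'
    linarith

/-- A nonnegative integer matrix splits into `n` parts with entries, row sums and column sums
differing by at most one between any two parts. -/
theorem exists_equitable_splitting {L J : Type*} [Fintype L] [Fintype J] {n : ℕ} (hn : 0 < n)
    (g : L → J → ℕ) :
    ∃ F : Fin n → L → J → ℕ, (∀ l j, ∑ i, F i l j = g l j) ∧
      (∀ a b l j, F a l j ≤ F b l j + 1) ∧
      (∀ a b l, ∑ j, F a l j ≤ ∑ j, F b l j + 1) ∧
      ∀ a b j, ∑ l, F a l j ≤ ∑ l, F b l j + 1 := by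
  classical
  obtain ⟨F, hF, hmin⟩ : ∃ F : Fin n → L → J → ℕ, (∀ l j, ∑ i, F i l j = g l j) ∧
      ∀ F' : Fin n → L → J → ℕ, (∀ l j, ∑ i, F' i l j = g l j) →
        ∑ i, marginSqSum (F i) ≤ ∑ i, marginSqSum (F' i) := by
    obtain ⟨F, hF, hmin⟩ := exists_minimalFor_of_wellFoundedLT
      (fun F : Fin n → L → J → ℕ => ∀ l j, ∑ i, F i l j = g l j)
      (fun F => ∑ i, marginSqSum (F i))
      -- Some splitting exists: put everything in part `0`.
      ⟨fun i l j => if i = ⟨0, hn⟩ then g l j else 0, fun l j => by simp⟩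
    exact ⟨F, hF, fun F' hF' => (le_total _ _).elim id (hmin hF')⟩
  have main : ∀ a b, (∀ l j, F a l j ≤ F b l j + 1) ∧
      (∀ l, ∑ j, F a l j ≤ ∑ j, F b l j + 1) ∧ ∀ j, ∑ l, F a l j ≤ ∑ l, F b l j + 1 := by
    intro a b
    by_cases hab : a = b
    · subst hab; simp
    obtain ⟨A, B, hAB, h1, h2, h3⟩ := exists_balanced_halving fun l j => F a l j + F b l j
    refine balanced_of_marginSqSum_le hAB h1 h2 h3 ?_
    by_contra! hlt
    let F' := Function.update (Function.update F a A) b B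
    have ha : F' a = A := by simp [F', hab]
    have hb : F' b = B := by simp [F']
    have hoff : ∀ i, i ≠ a → i ≠ b → F' i = F i := fun i hi hi' => by simp [F', hi, hi']
    refine (hmin F' fun l j => ?_).not_gt <| Finset.sum_lt_sum_of_eq_off_pair hab
      (fun i hi hi' => by rw [hoff i hi hi']) (by rwa [ha, hb])
    rw [← hF l j, ← Finset.sum_sdiff (Finset.subset_univ {a, b}),
      ← Finset.sum_sdiff (s₂ := Finset.univ) (f := fun i => F i l j)
      (Finset.subset_univ {a, b}), Finset.sum_pair hab, Finset.sum_pair hab, ha, hb, hAB,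
      Finset.sum_congr rfl]
    intro i hi
    simp only [Finset.mem_sdiff, Finset.mem_univ, Finset.mem_insert, Finset.mem_singleton,
      true_and, not_or] at hi
    rw [hoff i hi.1 hi.2]
  exact ⟨F, hF, fun a b => (main a b).1, fun a b => (main a b).2.1, fun a b => (main a b).2.2⟩

/-! ### Construction of the array -/

/-- One value above `c` forces all values to be at least `c`, so the sum exceeds `n * c`. -/
theorem le_of_sum_le_mul_of_balanced {n : ℕ} {f : Fin n → ℕ} {c : ℕ} (hf : ∀ a b, f a ≤ f b + 1)
    (hsum : ∑ i, f i ≤ n * c) (a : Fin n) : f a ≤ c := by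
  by_contra! h
  have : ∑ _i : Fin n, c < ∑ i, f i :=
    Finset.sum_lt_sum (fun i _ => by have := hf a i; omega) ⟨a, Finset.mem_univ _, h⟩
  simp at this
  omega

theorem eq_of_sum_eq_mul_of_balanced {n : ℕ} {f : Fin n → ℕ} {c : ℕ} (hf : ∀ a b, f a ≤ f b + 1)
    (hsum : ∑ i, f i = n * c) (a : Fin n) : f a = c := by
  have hle := le_of_sum_le_mul_of_balanced hf hsum.le
  have h : ∑ i, f i = ∑ _i : Fin n, c := by simpa using hsum
  exact (Finset.sum_eq_sum_iff_of_le fun i _ => hle i).1 h a (Finset.mem_univ _)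

/-- The occurrence numbers of an equitable array: every symbol is spread evenly over the columns,
and then over the cells of each column. -/
theorem exists_equitable_counts {n k lam : ℕ} (hn : 0 < n) {rho : Fin k → ℕ}
    (hrho_le : ∀ l, rho l ≤ lam * n) (hsum : ∑ l, rho l = lam * n ^ 2) :
    ∃ f : Fin k → Fin n → Fin n → ℕ, (∀ i j, ∑ l, f l i j = lam) ∧
      (∀ l, ∑ i, ∑ j, f l i j = rho l) ∧ (∀ l i, ∑ j, f l i j ≤ lam) ∧
      (∀ l j, ∑ i, f l i j ≤ lam) ∧ ∀ l, rho l ≤ n ^ 2 → ∀ i j, f l i j ≤ 1 := by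
  -- `G j l ()` counts symbol `l` in column `j`; below, `F i l j` counts it in cell `(i, j)`.
  obtain ⟨G, hG, hGe, -, hGc⟩ := exists_equitable_splitting hn fun l (_ : Unit) => rho l
  obtain ⟨F, hF, hFe, hFr, hFc⟩ := exists_equitable_splitting hn fun l j => G j l ()
  have hGle : ∀ l c, rho l ≤ n * c → ∀ j, G j l () ≤ c := fun l c hc j =>
    le_of_sum_le_mul_of_balanced (f := fun j => G j l ()) (fun a b => hGe a b l ())
      ((hG l ()).trans_le hc) j
  have hGcol : ∀ j, ∑ l, G j l () = n * lam := by
    refine eq_of_sum_eq_mul_of_balanced (fun a b => hGc a b ()) ?_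
    rw [Finset.sum_comm]
    simp only [hG, hsum]
    ring
  refine ⟨fun l i j => F i l j, fun i j => ?_, fun l => ?_, fun l i => ?_, fun l j => ?_,
    fun l hl i j => ?_⟩
  · refine eq_of_sum_eq_mul_of_balanced (f := fun i => ∑ l, F i l j) (fun a b => hFc a b j) ?_ i
    rw [Finset.sum_comm]
    simp only [hF, hGcol]
  · rw [Finset.sum_comm]
    simp only [hF, hG]
  · refine le_of_sum_le_mul_of_balanced (f := fun i => ∑ j, F i l j) (fun a b => hFr a b l) ?_ i
    rw [Finset.sum_comm]
    simp only [hF, hG]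
    rw [mul_comm]
    exact hrho_le l
  · rw [hF]
    exact hGle l lam (by rw [mul_comm]; exact hrho_le l) j
  · refine le_of_sum_le_mul_of_balanced (f := fun i => F i l j) (fun a b => hFe a b l j) ?_ i
    rw [hF, mul_one]
    exact hGle l n (by rwa [← sq]) j

theorem SymbolArray.exists_cellCount_eq {r s k : ℕ} (f : Fin k → Fin r → Fin s → ℕ) :
    ∃ M : SymbolArray r s k, (∀ l i j, M.cellCount l i j = f l i j) ∧
      ∀ i j, (M i j).card = ∑ l, f l i j := by
  refine ⟨fun i j => ∑ l, Multiset.replicate (f l i j) l, fun l i j => ?_, fun i j => ?_⟩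
  · simp [cellCount, Multiset.count_sum', Multiset.count_replicate]
  · simp

theorem exists_isLatinSquare {n k lam : ℕ} (hn : 0 < n) {rho : Fin k → ℕ}
    (hrho_le : ∀ l, rho l ≤ lam * n) (hsum : ∑ l, rho l = lam * n ^ 2) :
    ∃ M : SymbolArray n n k, M.IsLatinSquare rho lam ∧ ((∀ l, rho l ≤ n ^ 2) → M.IsSimple) := by
  obtain ⟨f, h1, h2, h3, h4, h5⟩ := exists_equitable_counts hn hrho_le hsum
  obtain ⟨M, hM, hcard⟩ := SymbolArray.exists_cellCount_eq f
  refine ⟨M, ⟨fun i j => (hcard i j).trans (h1 i j), fun l => ?_, fun l i => ?_, fun l j => ?_⟩,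
    fun h l i j => (hM l i j).trans_le (h5 l (h l) i j)⟩
  · simpa only [SymbolArray.totalCount, hM] using h2 l
  · simpa only [SymbolArray.rowCount, hM] using h3 l i
  · simpa only [SymbolArray.colCount, hM] using h4 l j

namespace SymbolArray

theorem IsSimple.le_of_isMatrix {r s k lam : ℕ} {M : SymbolArray r s k} (hs : M.IsSimple)
    (hM : M.IsMatrix lam) (i : Fin r) (j : Fin s) : lam ≤ k := by
  have hnd : (M i j).Nodup := Multiset.nodup_iff_count_le_one.2 fun l => hs l i j
  rw [← hM i j, ← Multiset.toFinset_card_of_nodup hnd]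
  simpa using Finset.card_le_univ (M i j).toFinset

theorem IsSimple.totalCount_le {n k : ℕ} {M : SymbolArray n n k} (hs : M.IsSimple) (l : Fin k) :
    M.totalCount l ≤ n ^ 2 := by
  calc M.totalCount l ≤ ∑ _i : Fin n, ∑ _j : Fin n, 1 :=
        Finset.sum_le_sum fun i _ => Finset.sum_le_sum fun j _ => hs l i j
    _ = n ^ 2 := by simp [sq]

end SymbolArray

theorem mainTheorem8 (n k lam : ℕ) (hn : 1 ≤ n) (hk : 1 ≤ k) (hlam : 1 ≤ lam)
    (rho : Fin k → ℕ)
    (hrho_pos : ∀ l, 1 ≤ rho l)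
    (hrho_le : ∀ l, rho l ≤ lam * n)
    (hnk : lam * n ≤ lam * k)
    (hsum : ∑ l, rho l = lam * n ^ 2) :
    (∃ M : SymbolArray n n k, M.IsLatinSquare rho lam) ∧
    ((∃ M : SymbolArray n n k, M.IsLatinSquare rho lam ∧ M.IsSimple) ↔
      lam ≤ k ∧ ∀ l, rho l ≤ n ^ 2) := by
  obtain ⟨M, hM, hsimple⟩ := exists_isLatinSquare hn hrho_le hsum
  refine ⟨⟨M, hM⟩, ?_, fun h => ⟨M, hM, hsimple h.2⟩⟩
  rintro ⟨N, hN, hs⟩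
  exact ⟨hs.le_of_isMatrix hN.isMatrix ⟨0, hn⟩ ⟨0, hn⟩,
    fun l => hN.totalCount_eq l ▸ hs.totalCount_le l⟩
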